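/- Let $k\ge 2$ and let $H=K_{k+1}^{(k)}$ be the $k$-uniform simplex, i.e. the hypergraph on $[k+1]$ whose edges are all $k$-element subsets, each taken once. For a $k$-element set $e$ and $u\in e$, the star $S_e(u)$ is the digraph on $e$ with arcs $u\to v$ for all $v\in e\setminus\{u\}$. A rooting of $H$ is a sequence $R=(S_{e_1}(v_1),\dots,S_{e_m}(v_m))$ in which $e_1,\dots,e_m$ are the edges of $H$ (with their multiplicities), $v_i\in e_i$ and $v_1\le\dots\le v_m$; its digraph $D_R$ is the union of these stars, with arc multiplicities added. $R$ is an Euler rooting if $D_R$ has an Euler circuit. For a multi-digraph $D$ and a vertex $r$ let $\tau_r(D)$ be the number of spanning arborescences of $D$ rooted at $r$. The associated coefficient of a connected $k$-uniform multi-hypergraph $H$ all of whose vertex degrees are divisible by $k$ is $$C_H=\sum_{R\text{ Euler rooting of }H}\frac{\tau_r(D_R)}{\prod_{v\in V(D_R)}\deg^-_{D_R}(v)},$$ where $r$ is a specified vertex. Let $\mathfrak D_{k+1}$ be the set of derangements of $[k+1]$, and for $\sigma\in\mathfrak D_{k+1}$ let $\ell_1,\dots,\ell_t$ be the lengths of the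 cycles of $\sigma$. Then, for the simplex $H$ and every choice of the root $r$, $$C_H=\frac{1}{(k-1)^{k+1}(k+1)^2}\sum_{\sigma\in\mathfrak D_{k+1}}\ \prod_{i=1}^{t}\left(k^{\ell_i}+(-1)^{\ell_i+1}\right).$$ Moreover, if in the definition of $C_H$ the number $\tau_r(D_R)$ is replaced by the number $\sum_{r}\tau_r(D_R)$ of arborescences of $D_R$ with arbitrary root, then the resulting sum equals $$\frac{1}{(k-1)^{k+1}(k+1)}\sum_{\sigma\in\mathfrak D_{k+1}}\ \prod_{i=1}^{t}\left(k^{\ell_i}+(-1)^{\ell_i+1}\right).$$ -/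

import Mathlib

open scoped BigOperators

/-! ### Multi-digraphs -/

/-- A finite multi-digraph with vertices in `V`: a finite vertex set and a finite multiset of arcs
`(tail, head)` joining vertices of that set. -/
structure MultiDigraph (V : Type*) where
  verts : Finset V
  arcs : Multiset (V × V)
  mem_verts : ∀ a ∈ arcs, a.1 ∈ verts ∧ a.2 ∈ verts

namespace MultiDigraph

variable {V : Type*} [DecidableEq V]

/-- The in-degree of `v`: the number of arcs with head `v`, counted with multiplicity. -/
def inDeg (D : MultiDigraph V) (v : V) : ℕ :=
  D.arcs.countP (fun a => a.2 = v)

/-- `D` is Eulerian: it has an Euler circuit, that is, a cyclic sequence of arcs that runs through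
every arc of `D` exactly once (parallel arcs as often as their multiplicity), each arc starting at
the head of the preceding one. -/
def IsEulerian (D : MultiDigraph V) : Prop :=
  ∃ c : Cycle (V × V), c.toMultiset = D.arcs ∧ c.Chain (fun a b => a.2 = b.1)

/-- The finite set of labelled arcs of `D`; parallel arcs are distinguished by their second
component. -/
def arcSet (D : MultiDigraph V) : Finset ((V × V) × ℕ) :=
  D.arcs.toEnumFinset

/-- A set `T` of arcs of `D` is a (spanning) arborescence of `D` with root `r`: no arc of `T` enters
`r`, exactly one arc of `T` enters each other vertex, and every vertex can be reached from `r`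
by a directed walk in `T`. -/
structure IsArborescence (D : MultiDigraph V) (r : V) (T : Finset ((V × V) × ℕ)) : Prop where
  root_mem : r ∈ D.verts
  subset : T ⊆ D.arcSet
  root : ∀ a ∈ T, a.1.2 ≠ r
  unique_in : ∀ v ∈ D.verts, v ≠ r → ∃! a, a ∈ T ∧ a.1.2 = v
  reach : ∀ v ∈ D.verts, Relation.ReflTransGen (fun x y => ∃ a ∈ T, a.1 = (x, y)) r v

open Classical in
/-- The number of arborescences of `D` with the specified root `r`. -/
noncomputable def numArborescencesAt (D : MultiDigraph V) (r : V) : ℕ :=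
  (D.arcSet.powerset.filter (fun T => D.IsArborescence r T)).card

/-- The number of all arborescences of `D`, over all possible roots. -/
noncomputable def numArborescences (D : MultiDigraph V) : ℕ :=
  ∑ r ∈ D.verts, D.numArborescencesAt r

end MultiDigraph

/-! ### Multi-hypergraphs, rootings, associated coefficients -/

/-- A finite multi-hypergraph with vertices in `V`. -/
structure MultiHypergraph (V : Type*) where
  verts : Finset V
  edges : Multiset (Finset V)
  edge_subset : ∀ e ∈ edges, e ⊆ verts

namespace MultiHypergraph

section Basic

variable {V : Type*} [DecidableEq V]

/-- The degree of a vertex: the number of edges containing it, counted with multiplicity. -/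
def degree (H : MultiHypergraph V) (v : V) : ℕ :=
  H.edges.countP (fun e => v ∈ e)

/-- A Veblen hypergraph: `k`-uniform and `k`-valent. -/
structure IsVeblen (H : MultiHypergraph V) (k : ℕ) : Prop where
  uniform : ∀ e ∈ H.edges, e.card = k
  valent : ∀ v ∈ H.verts, k ∣ H.degree v

/-- A hypergraph is connected if it has a vertex and any two vertices are joined by a walk in which
consecutive vertices share an edge. -/
structure IsConnected (H : MultiHypergraph V) : Prop where
  nonempty : H.verts.Nonempty
  joined : ∀ u ∈ H.verts, ∀ v ∈ H.verts,
    Relation.ReflTransGen (fun x y => ∃ e ∈ H.edges, x ∈ e ∧ y ∈ e) u v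

end Basic

section Rooting

variable {V : Type*} [LinearOrder V]

/-- A rooting of `H`: an ordering `(S_{e₁}(v₁), …, S_{eₘ}(vₘ))` of rooted stars, where the `eᵢ` are the
edges of `H` with their multiplicities, `vᵢ ∈ eᵢ`, and `vᵢ ≤ vᵢ₊₁`. The star `S_e(v)` is recorded
as the pair `(e, v)`. -/
structure IsRooting (H : MultiHypergraph V) (R : List (Finset V × V)) : Prop where
  edges_eq : (R.map Prod.fst : Multiset (Finset V)) = H.edges
  root_mem : ∀ s ∈ R, s.2 ∈ s.1
  sorted : R.Pairwise (fun s t => s.2 ≤ t.2)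

/-- The arcs `u → v`, `v ∈ e`, `v ≠ u`, of the `u`-rooted directed star of `e`. -/
def starArcs (s : Finset V × V) : Multiset (V × V) :=
  (s.1.erase s.2).val.map (fun v => (s.2, v))

/-- The rooted multi-digraph `D_R` of a sequence `R` of rooted stars: the union of the stars, with
multiplicities of arcs added. The vertex set of `S_e(v)` is written `insert v e`, which is `e`
whenever `v ∈ e`. -/
def rootedDigraph (R : List (Finset V × V)) : MultiDigraph V where
  verts := R.toFinset.biUnion (fun s => insert s.2 s.1)
  arcs := (R : Multiset (Finset V × V)).bind starArcs
  mem_verts := by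
    intro a ha
    obtain ⟨s, hs, ham⟩ := Multiset.mem_bind.1 ha
    rw [Multiset.mem_coe] at hs
    obtain ⟨v, hv, rfl⟩ := Multiset.mem_map.1 ham
    simp only [Finset.mem_biUnion, List.mem_toFinset]
    exact ⟨⟨s, hs, Finset.mem_insert_self _ _⟩,
      ⟨s, hs, Finset.mem_insert_of_mem (Finset.mem_of_mem_erase hv)⟩⟩

/-- An Euler rooting of `H`: a rooting `R` such that `D_R` is Eulerian. -/
def IsEulerRooting (H : MultiHypergraph V) (R : List (Finset V × V)) : Prop :=
  H.IsRooting R ∧ (rootedDigraph R).IsEulerian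

theorem finite_eulerRootings (H : MultiHypergraph V) :
    {R | H.IsEulerRooting R}.Finite := by
  refine (List.finite_length_eq (H.edges.toFinset ×ˢ H.verts : Finset (Finset V × V))
    (Multiset.card H.edges)).image (List.map Subtype.val) |>.subset ?_
  rintro R ⟨hR, -⟩
  have hmem : ∀ s ∈ R, s ∈ H.edges.toFinset ×ˢ H.verts := by
    intro s hs
    have he : s.1 ∈ H.edges := by
      rw [← hR.edges_eq, Multiset.mem_coe]
      exact List.mem_map_of_mem hs
    exact Finset.mem_product.2
      ⟨Multiset.mem_toFinset.2 he, H.edge_subset _ he (hR.root_mem s hs)⟩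
  refine ⟨R.attach.map (fun s => ⟨s.1, hmem s.1 s.2⟩), ?_, ?_⟩
  · have h := congrArg Multiset.card hR.edges_eq
    simpa using h
  · simp only [List.map_map, Function.comp_def]
    exact List.attach_map_subtype_val R

/-- The finite set of Euler rootings `R` of `H`. It indexes the multiset of the Eulerian digraphs
`D_R`. -/
noncomputable def eulerRootings (H : MultiHypergraph V) : Finset (List (Finset V × V)) :=
  H.finite_eulerRootings.toFinset

end Rooting

end MultiHypergraph

/-- A connected Veblen `k`-hypergraph with vertices in `V`. -/
structure ConnectedVeblen (V : Type*) [DecidableEq V] (k : ℕ) extends MultiHypergraph V where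
  isVeblen : toMultiHypergraph.IsVeblen k
  isConnected : toMultiHypergraph.IsConnected

namespace ConnectedVeblen

variable {V : Type*} [LinearOrder V] {k : ℕ}

/-- The associated coefficient `C_H = ∑_{D ∈ R(H)} τ_D / ∏_{v ∈ V(D)} deg⁻(v)` of a connected Veblen
hypergraph, where `τ_D` is the number of arborescences of `D` with the specified root `r`. -/
noncomputable def assocCoeff (H : ConnectedVeblen V k) (r : V) : ℚ :=
  ∑ R ∈ H.eulerRootings,
    ((MultiHypergraph.rootedDigraph R).numArborescencesAt r : ℚ) /
      ∏ v ∈ (MultiHypergraph.rootedDigraph R).verts, ((MultiHypergraph.rootedDigraph R).inDeg v : ℚ)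

/-- The same sum, with `τ_D` the number of all arborescences of `D`, over all possible roots. -/
noncomputable def assocCoeffAllRoots (H : ConnectedVeblen V k) : ℚ :=
  ∑ R ∈ H.eulerRootings,
    ((MultiHypergraph.rootedDigraph R).numArborescences : ℚ) /
      ∏ v ∈ (MultiHypergraph.rootedDigraph R).verts, ((MultiHypergraph.rootedDigraph R).inDeg v : ℚ)

end ConnectedVeblen

/-! ### The simplex -/

/-- The `k`-uniform simplex: all `k`-element subsets of a `(k+1)`-element vertex set, each an edge of
multiplicity one. -/
def simplexHypergraph (k : ℕ) : MultiHypergraph (Fin (k + 1)) where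
  verts := Finset.univ
  edges := (Finset.powersetCard k Finset.univ).val
  edge_subset := fun e _ => Finset.subset_univ e

theorem simplexHypergraph_mem_edges {k : ℕ} {e : Finset (Fin (k + 1))} :
    e ∈ (simplexHypergraph k).edges ↔ e.card = k := by
  simp [simplexHypergraph, Finset.mem_powersetCard]

theorem simplexHypergraph_degree (k : ℕ) (v : Fin (k + 1)) :
    (simplexHypergraph k).degree v = k := by
  have hE : (Finset.powersetCard k (Finset.univ : Finset (Fin (k + 1)))) =
      Finset.univ.image (fun i : Fin (k + 1) => Finset.univ.erase i) := by
    ext e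
    simp only [Finset.mem_powersetCard, Finset.subset_univ, true_and, Finset.mem_image,
      Finset.mem_univ]
    constructor
    · intro he
      have hc : eᶜ.card = 1 := by rw [Finset.card_compl, Fintype.card_fin, he]; omega
      obtain ⟨i, hi⟩ := Finset.card_eq_one.1 hc
      exact ⟨i, by rw [← compl_compl e, hi]; ext; simp⟩
    · rintro ⟨i, rfl⟩
      simp
  have hinj : Function.Injective
      (fun i : Fin (k + 1) => (Finset.univ : Finset (Fin (k + 1))).erase i) := by
    intro i j hij
    by_contra hne
    have : i ∈ (Finset.univ : Finset (Fin (k + 1))).erase j := by simp [hne]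
    have h2 : i ∈ (Finset.univ : Finset (Fin (k + 1))).erase i := by
      have h3 : (Finset.univ : Finset (Fin (k + 1))).erase i = Finset.univ.erase j := hij
      rw [h3]; exact this
    simp at h2
  have h1 : (simplexHypergraph k).degree v =
      ((Finset.powersetCard k (Finset.univ : Finset (Fin (k + 1)))).filter
        (fun e => v ∈ e)).card := by
    rw [MultiHypergraph.degree, Multiset.countP_eq_card_filter]
    rfl
  rw [h1, hE, Finset.filter_image, Finset.card_image_of_injective _ hinj]
  have h2 : (Finset.univ.filter
      (fun i : Fin (k + 1) => v ∈ (Finset.univ : Finset (Fin (k + 1))).erase i)) =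
      Finset.univ.erase v := by
    ext i; simp [eq_comm]
  rw [h2]
  simp

/-- The `k`-uniform simplex, as a connected Veblen hypergraph. -/
def simplex (k : ℕ) (hk : 2 ≤ k) : ConnectedVeblen (Fin (k + 1)) k where
  toMultiHypergraph := simplexHypergraph k
  isVeblen :=
    { uniform := fun _ he => simplexHypergraph_mem_edges.1 he
      valent := fun v _ => by rw [simplexHypergraph_degree] }
  isConnected :=
    { nonempty := ⟨0, Finset.mem_univ _⟩
      joined := fun u _ v _ => by
        refine Relation.ReflTransGen.single ?_
        obtain ⟨e, h1, -, h3⟩ := Finset.exists_subsuperset_card_eq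
          (Finset.subset_univ ({u, v} : Finset (Fin (k + 1))))
          (Finset.card_le_two.trans hk) (by simp : k ≤ (Finset.univ : Finset (Fin (k + 1))).card)
        exact ⟨e, simplexHypergraph_mem_edges.2 h3, h1 (by simp), h1 (by simp)⟩ }

/-! ### Euler circuits: balance and connectivity -/

namespace MultiDigraph

variable {V : Type*} [DecidableEq V]

/-! Let c(v) be the number of edges rooted at v. In D_R the vertex v has out-degree (k-1)c(v) and
in-degree deg v - c(v), and an Euler circuit forces these to agree, so k·c(v) = deg v = k. Every
vertex is thus the root of exactly one edge, and the edge rooted at v omits one vertex σ(v) ≠ v.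
Since the roots are listed in increasing order, R is determined by the derangement σ. Conversely
each derangement gives a balanced digraph, strongly connected because k ≥ 2, hence Eulerian
(`isEulerian_of_balanced`).

All in-degrees are k-1, so only the arborescences remain to be counted. The in-degree Laplacian is L
= kI + P - J, with P the permutation matrix of σ⁻¹ and J the all-ones matrix. By the matrix-tree
theorem (`numArborescencesAt_eq_det`) the count is a cofactor of L. As the rows and columns of L sum
to zero, (k+1)² times this cofactor is det(L + J) = det(kI + P) (`det_add_one_eq_card_sq_mul`),
which factors over the cycles of σ (`det_smul_one_add_permMatrix`). The count does not depend on the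
root, so admitting all roots multiplies it by k+1. -/

theorem isChain_map_snd {W : Type*} (a : W × W) (l : List (W × W))
    (h : List.IsChain (fun a b : W × W => a.2 = b.1) (a :: l)) :
    ∃ z, (a :: l).getLast? = some z ∧ (a :: l).map Prod.snd = l.map Prod.fst ++ [z.2] := by
  induction l generalizing a with
  | nil => exact ⟨a, by simp⟩
  | cons b l ih =>
    rw [List.isChain_cons_cons] at h
    obtain ⟨z, hz, hm⟩ := ih b h.2
    refine ⟨z, by simpa using hz, ?_⟩
    rw [List.map_cons, hm, h.1]
    simp

/-- In an Eulerian digraph, every vertex is as often a tail as a head. -/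
theorem IsEulerian.map_fst_eq_map_snd {W : Type*} {D : MultiDigraph W} (h : D.IsEulerian) :
    D.arcs.map Prod.fst = D.arcs.map Prod.snd := by
  obtain ⟨c, hc, hch⟩ := h
  rw [← hc]
  induction c using Cycle.induction_on with
  | nil => simp
  | cons a l _ =>
    rw [Cycle.chain_coe_cons] at hch
    obtain ⟨z, hz, hm⟩ := isChain_map_snd _ _ hch
    have hza : a = z := by
      rw [← List.cons_append, List.getLast?_append] at hz
      simpa using hz
    subst hza
    -- The chain condition concerns `a :: l ++ [a]`, which lists `a` twice; its second head is
    -- cancelled.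
    have h2 : (a :: l).map Prod.snd = l.map Prod.fst ++ [a.1] := by
      apply List.append_cancel_right (bs := [a.2])
      simpa only [List.map_cons, List.map_append, List.map_nil, List.cons_append,
        List.append_assoc] using hm
    rw [Cycle.coe_toMultiset, Multiset.map_coe, Multiset.map_coe, h2, Multiset.coe_eq_coe]
    simpa using (List.perm_append_singleton a.1 (l.map Prod.fst)).symm

/-- In a balanced digraph, a trail that cannot be prolonged is closed. -/
theorem closed_of_maximal_trail {D : MultiDigraph V}
    (bal : D.arcs.map Prod.fst = D.arcs.map Prod.snd) {a z : V × V} {l : List (V × V)}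
    (hl : List.IsChain (fun a b : V × V => a.2 = b.1) (a :: l))
    (hz : (a :: l).getLast? = some z) {rest : Multiset (V × V)}
    (hrest : D.arcs = ((a :: l : List (V × V)) : Multiset (V × V)) + rest)
    (hmax : ∀ b ∈ rest, b.1 ≠ z.2) : z.2 = a.1 := by
  obtain ⟨z', hz', hm⟩ := isChain_map_snd _ _ hl
  obtain rfl : z = z' := by rw [hz] at hz'; exact Option.some.inj hz'
  rw [hrest, Multiset.map_add, Multiset.map_add, Multiset.map_coe, Multiset.map_coe, hm] at bal
  -- Every arc leaving `z.2` lies on the trail. If the trail were open, `z.2` would occur more often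
  -- as a head than as a tail.
  have hc := congrArg (Multiset.count z.2) bal
  have h0 : Multiset.count z.2 (rest.map Prod.fst) = 0 := by
    rw [Multiset.count_eq_zero, Multiset.mem_map]
    rintro ⟨b, hb, hbz⟩
    exact hmax b hb hbz
  rw [Multiset.count_add, Multiset.count_add, h0, Multiset.coe_count, Multiset.coe_count,
    List.map_cons, List.count_cons, List.count_append, List.count_singleton] at hc
  by_contra hne
  have hne' : ¬ a.1 = z.2 := fun h => hne h.symm
  simp [hne'] at hc
  omega

/-- A balanced digraph in which every arc can be reached from every other one is Eulerian. -/
theorem isEulerian_of_balanced {D : MultiDigraph V}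
    (bal : D.arcs.map Prod.fst = D.arcs.map Prod.snd)
    (conn : ∀ a ∈ D.arcs, ∀ b ∈ D.arcs,
      Relation.ReflTransGen (fun x y => (x, y) ∈ D.arcs) a.1 b.1) : D.IsEulerian := by
  classical
  rcases Multiset.empty_or_exists_mem D.arcs with h0 | ⟨a₀, ha₀⟩
  · exact ⟨Cycle.nil, by rw [h0]; rfl, Cycle.Chain.nil _⟩
  -- A longest trail is taken. Balance closes it, and connectivity will show that it uses every arc.
  let P : ℕ → Prop := fun n => ∃ l : List (V × V),
    List.IsChain (fun a b : V × V => a.2 = b.1) l ∧ (l : Multiset (V × V)) ≤ D.arcs ∧ l.length = n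
  have hbd : ∀ l : List (V × V), (l : Multiset (V × V)) ≤ D.arcs →
      l.length ≤ Multiset.card D.arcs := fun l hl => by
    simpa using Multiset.card_le_card hl
  have hP1 : P 1 := ⟨[a₀], List.isChain_singleton _, by simpa using ha₀, rfl⟩
  have hle1 : 1 ≤ Multiset.card D.arcs := hbd [a₀] (by simpa using ha₀)
  set n := Nat.findGreatest P (Multiset.card D.arcs) with hn
  obtain ⟨l, hch, hle, hlen⟩ : P n := Nat.findGreatest_spec hle1 hP1
  have hn1 : 1 ≤ n := Nat.le_findGreatest hle1 hP1
  have hmax : ∀ l' : List (V × V), List.IsChain (fun a b : V × V => a.2 = b.1) l' →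
      (l' : Multiset (V × V)) ≤ D.arcs → l'.length ≤ n := fun l' h1 h2 =>
    Nat.le_findGreatest (hbd l' h2) ⟨l', h1, h2, rfl⟩
  obtain ⟨a, t, rfl⟩ : ∃ a t, l = a :: t := by
    cases l with
    | nil => simp at hlen; omega
    | cons a t => exact ⟨a, t, rfl⟩
  obtain ⟨rest, hrest⟩ := Multiset.le_iff_exists_add.1 hle
  obtain ⟨z, hz, hm⟩ := isChain_map_snd _ _ hch
  have hext : ∀ l' : List (V × V), l'.Perm (a :: t) →
      List.IsChain (fun a b : V × V => a.2 = b.1) l' →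
      ∀ b ∈ rest, (∀ y ∈ l'.getLast?, y.2 = b.1) → False := by
    intro l' hp hc b hb hy
    have h1 := hmax (l' ++ [b])
      (List.isChain_append.2 ⟨hc, List.isChain_singleton _, by simpa using hy⟩) (by
        rw [hrest, ← Multiset.coe_add, Multiset.coe_eq_coe.2 hp]
        exact add_le_add_right (by simpa using hb) _)
    rw [List.length_append, hp.length_eq, hlen] at h1
    simp at h1
  have hclosed : z.2 = a.1 := closed_of_maximal_trail bal hch hz hrest
    fun b hb hbz => hext _ (List.Perm.refl _) hch b hb fun y hy => by
      rw [hz, Option.mem_some_iff] at hy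
      rw [← hy, hbz]
  have hheads : ∀ v, v ∈ (a :: t).map Prod.snd → v ∈ (a :: t).map Prod.fst := by
    intro v hv
    rw [hm, hclosed] at hv
    simpa [or_comm] using hv
  -- If an unused arc `b` leaves the tail of a trail arc `c`, the closed trail can be rotated to
  -- start at `c`. It then ends at the tail of `c`, and `b` prolongs it.
  have hno : ∀ b ∈ rest, b.1 ∉ (a :: t).map Prod.fst := by
    intro b hb hbt
    obtain ⟨c, hc, hcb⟩ := List.mem_map.1 hbt
    obtain ⟨l₁, l₂, hsplit⟩ := List.append_of_mem hc
    rw [hsplit] at hch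
    obtain ⟨hc1, hc2, hc3⟩ := List.isChain_append.1 hch
    rw [hsplit] at hz
    refine hext (c :: l₂ ++ l₁) (hsplit ▸ List.perm_append_comm)
      (List.isChain_append.2 ⟨hc2, hc1, ?_⟩) b hb ?_
    · intro x hx y hy
      have hxz : x = z := by
        rw [List.getLast?_append, Option.mem_def.1 hx] at hz
        simpa using hz
      cases l₁ with
      | nil => simp at hy
      | cons d l₁ =>
        simp at hy hsplit
        rw [hxz, hclosed, hsplit.1, hy]
    · intro y hy
      rw [List.getLast?_append] at hy
      rcases h : l₁.getLast? with _ | y'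
      · rw [List.getLast?_eq_none_iff] at h
        subst h
        have hyz : y = z := by simpa using hy.symm.trans hz
        simp at hsplit
        rw [hyz, hclosed, hsplit.1, hcb]
      · rw [h] at hy
        have : y' = y := by simpa using hy
        subst this
        rw [hc3 y' h c (by simp), hcb]
  have hreach : ∀ v, Relation.ReflTransGen (fun x y => (x, y) ∈ D.arcs) a.1 v →
      v ∈ (a :: t).map Prod.fst := by
    intro v hv
    induction hv with
    | refl => simp
    | tail _ hxy ih =>
      rw [hrest, Multiset.mem_add] at hxy
      rcases hxy with hxy | hxy
      · exact hheads _ (List.mem_map.2 ⟨_, hxy, rfl⟩)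
      · exact absurd ih (hno _ hxy)
  have hrest0 : rest = 0 := by
    refine Multiset.eq_zero_of_forall_notMem fun b hb => hno b hb (hreach _ (conn a ?_ b ?_))
    · rw [hrest]; simp
    · rw [hrest]; simp [hb]
  refine ⟨((a :: t : List (V × V)) : Cycle (V × V)), ?_, ?_⟩
  · rw [hrest, hrest0, Cycle.coe_toMultiset, add_zero]
  · rw [Cycle.chain_coe_cons, ← List.cons_append]
    refine List.isChain_append.2 ⟨hch, List.isChain_singleton _, ?_⟩
    intro x hx y hy
    rw [hz, Option.mem_some_iff] at hx
    simp at hy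
    rw [← hx, hclosed, hy]

end MultiDigraph

/-! ### Cofactors of Laplacians and determinants of parent functions -/

namespace Matrix

variable {V : Type*} [Fintype V] [DecidableEq V]

theorem det_one_add_vecMulVec {R : Type*} [CommRing R] (u v : V → R) :
    (1 + vecMulVec u v).det = 1 + v ⬝ᵥ u := by
  rw [vecMulVec_eq Unit, det_one_add_replicateCol_mul_replicateRow]

/-- If all row and column sums of `L` vanish, adding `1` to every entry multiplies each
principal cofactor by the square of the size. -/
theorem det_add_one_eq_card_sq_mul {R : Type*} [CommRing R] (L : Matrix V V R)
    (hrow : L *ᵥ 1 = 0) (hcol : 1 ᵥ* L = 0) (r : V) :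
    (L + vecMulVec 1 1).det =
      (Fintype.card V : R) ^ 2 * (L + vecMulVec (Pi.single r 1) (Pi.single r 1)).det := by
  have hdot : (1 : V → R) ⬝ᵥ (1 - Pi.single r 1) = Fintype.card V - 1 := by
    simp [dotProduct_sub]
  -- L + J is reached from L + e_r e_rᵀ by one left and one right factor of the form 1 + uvᵀ. Both
  -- have determinant 1 + (n-1) = n, whence the square.
  have h1 : (L + vecMulVec 1 (Pi.single r 1)) * (1 + vecMulVec 1 (1 - Pi.single r 1)) =
      L + vecMulVec 1 1 := by
    rw [mul_add, mul_one, add_mul, mul_vecMulVec, hrow, vecMulVec_mul_vecMulVec, vecMulVec_sub]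
    ext i j
    simp
  have h2 : (1 + vecMulVec (1 - Pi.single r 1) 1) *
      (L + vecMulVec (Pi.single r 1) (Pi.single r 1)) = L + vecMulVec 1 (Pi.single r 1) := by
    rw [mul_add, add_mul, one_mul, add_mul, one_mul, vecMulVec_mul, hcol,
      vecMulVec_mul_vecMulVec, sub_vecMulVec]
    ext i j
    simp [vecMulVec_apply]
    ring
  rw [← h1, det_mul, ← h2, det_mul, det_one_add_vecMulVec, det_one_add_vecMulVec, hdot,
    dotProduct_comm, hdot]
  ring

/-- The cofactor of `L` at `r` is the determinant of `L` with row `r` replaced by the unit vector. -/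
theorem det_updateRow_single_eq {K : Type*} [Field K] (L : Matrix V V K) [Nonempty V]
    (hrow : L *ᵥ 1 = 0) (r : V) :
    (L.updateRow r (Pi.single r 1)).det =
      (L + vecMulVec (Pi.single r 1) (Pi.single r 1)).det := by
  -- Adding e_r to row r changes the determinant by that of the matrix with row r replaced; the
  -- other summand, det L, vanishes because 1 is in the kernel.
  have h0 : L.det = 0 := exists_mulVec_eq_zero_iff.1 ⟨1, one_ne_zero, hrow⟩
  have h : L + vecMulVec (Pi.single r 1) (Pi.single r 1) =
      L.updateRow r (L r + Pi.single r 1) := by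
    ext i j
    by_cases hi : i = r
    · subst hi; simp [vecMulVec_apply]
    · simp [vecMulVec_apply, hi]
  rw [h, det_updateRow_add, updateRow_eq_self, h0, zero_add]

/-- The matrix with rows `e_v - e_{q v}` for `v ≠ r`, and `e_r`, for a parent function `q`. -/
def parentMatrix (K : Type*) [Ring K] (r : V) (q : V → V) : Matrix V V K :=
  of fun v => Pi.single v 1 - if v = r then 0 else Pi.single (q v) 1

/-- The matrix is 1 - N, where N sends each non-root row to its parent's row and has row r zero.
Climbing from any vertex ends at r, so N is nilpotent, and its characteristic polynomial Xⁿ takes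
the value 1 at 1. -/
theorem det_parentMatrix_of_reach (K : Type*) [Field K] (r : V) (q : V → V)
    (h : ∀ v, Relation.ReflTransGen (fun x y => y ≠ r ∧ q y = x) r v) :
    (parentMatrix K r q).det = 1 := by
  classical
  let N : Matrix V V K := of fun v => if v = r then 0 else Pi.single (q v) 1
  have hN : ∀ (v : V) (M : Matrix V V K), (N * M) v = if v = r then 0 else M (q v) := by
    intro v M
    ext j
    by_cases hv : v = r <;> simp [N, mul_apply, hv, Pi.single_apply]
  have hpow : ∀ v, ∃ m, (N ^ m) v = 0 := by
    intro v
    induction h v with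
    | refl => exact ⟨1, by rw [pow_one, ← mul_one N, hN]; simp⟩
    | tail _ hxy ih =>
      obtain ⟨m, hm⟩ := ih
      exact ⟨m + 1, by rw [pow_succ', hN, if_neg hxy.1, hxy.2, hm]⟩
  choose m hm using hpow
  have hnil : IsNilpotent N := by
    refine ⟨∑ v, m v, ?_⟩
    ext v j
    obtain ⟨d, hd⟩ := Nat.exists_eq_add_of_le
      (Finset.single_le_sum (fun i _ => Nat.zero_le (m i)) (Finset.mem_univ v))
    rw [hd, pow_add, mul_apply]
    simp [hm]
  have hch : N.charpoly = Polynomial.X ^ Fintype.card V :=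
    sub_eq_zero.1 (isNilpotent_charpoly_sub_pow_of_isNilpotent hnil).eq_zero
  have := eval_charpoly N 1
  rw [hch] at this
  have hM : parentMatrix K r q = scalar V (1 : K) - N := by
    ext i j
    simp [parentMatrix, N, one_apply, Pi.single_apply, eq_comm]
  rw [hM, ← this]
  simp

/-- A non-root vertex is reachable from r exactly when its parent is, so the indicator of the
unreachable vertices is a nonzero kernel vector. -/
theorem det_parentMatrix_of_not_reach (K : Type*) [Field K] (r : V) (q : V → V)
    (h : ¬ ∀ v, Relation.ReflTransGen (fun x y => y ≠ r ∧ q y = x) r v) :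
    (parentMatrix K r q).det = 0 := by
  classical
  obtain ⟨w, hw⟩ := not_forall.1 h
  rw [← exists_mulVec_eq_zero_iff]
  refine ⟨fun v => if Relation.ReflTransGen (fun x y => y ≠ r ∧ q y = x) r v then 0 else 1,
    fun h0 => by simpa [hw] using congrFun h0 w, ?_⟩
  ext v
  by_cases hv : v = r
  · subst hv
    simp [parentMatrix, mulVec, Relation.ReflTransGen.refl]
  · have hiff : Relation.ReflTransGen (fun x y => y ≠ r ∧ q y = x) r v ↔
        Relation.ReflTransGen (fun x y => y ≠ r ∧ q y = x) r (q v) := by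
      constructor
      · intro hr
        rcases Relation.ReflTransGen.cases_tail hr with h1 | ⟨x, hx, -, rfl⟩
        · exact absurd h1 hv
        · exact hx
      · exact fun hr => hr.tail ⟨hv, rfl⟩
    change (Pi.single v 1 - if v = r then 0 else Pi.single (q v) 1 : V → K) ⬝ᵥ _ = 0
    rw [if_neg hv, sub_dotProduct, single_one_dotProduct, single_one_dotProduct, sub_eq_zero]
    exact if_congr hiff rfl rfl

end Matrix

/-! ### The matrix-tree theorem -/

namespace MultiDigraph

variable {V : Type*} [Fintype V] [DecidableEq V]

/-- The arc that enters `v` in a choice of labelled arcs, with a dummy loop at the root. -/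
def parentChoices (D : MultiDigraph V) (r v : V) : Finset ((V × V) × ℕ) :=
  if v = r then {((r, r), 0)} else D.arcSet.filter (fun a => a.1.2 = v)

-- An arborescence amounts to an independent choice of an entering arc at each non-root vertex,
-- subject to reachability. The product form matches the expansion of a determinant along all rows.
open Classical in
theorem numArborescencesAt_eq_card_parent (D : MultiDigraph V) (hD : D.verts = Finset.univ) (r : V) :
    D.numArborescencesAt r = ((Fintype.piFinset (D.parentChoices r)).filter
      (fun p => ∀ v, Relation.ReflTransGen (fun x y => y ≠ r ∧ (p y).1.1 = x) r v)).card := by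
  symm
  have hsnd : ∀ p ∈ Fintype.piFinset (D.parentChoices r), ∀ v, (p v).1.2 = v := by
    intro p hp v
    have := Fintype.mem_piFinset.1 hp v
    unfold parentChoices at this
    split_ifs at this with hv
    · rw [Finset.mem_singleton.1 this, hv]
    · exact (Finset.mem_filter.1 this).2
  have hmem : ∀ p ∈ Fintype.piFinset (D.parentChoices r), ∀ v, v ≠ r → p v ∈ D.arcSet := by
    intro p hp v hv
    have := Fintype.mem_piFinset.1 hp v
    rw [parentChoices, if_neg hv] at this
    exact (Finset.mem_filter.1 this).1
  refine Finset.card_bij (fun p _ => (Finset.univ.erase r).image p) ?_ ?_ ?_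
  · intro p hp
    obtain ⟨hp, hreach⟩ := Finset.mem_filter.1 hp
    have hsub : (Finset.univ.erase r).image p ⊆ D.arcSet := by
      intro a ha
      obtain ⟨v, hv, rfl⟩ := Finset.mem_image.1 ha
      exact hmem p hp v (Finset.ne_of_mem_erase hv)
    refine Finset.mem_filter.2 ⟨Finset.mem_powerset.2 hsub, ?_, hsub, ?_, ?_, ?_⟩
    · simp [hD]
    · intro a ha
      obtain ⟨v, hv, rfl⟩ := Finset.mem_image.1 ha
      rw [hsnd p hp]
      exact Finset.ne_of_mem_erase hv
    · intro v _ hv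
      refine ⟨p v, ⟨Finset.mem_image_of_mem _ (by simp [hv]), hsnd p hp v⟩, ?_⟩
      rintro a ⟨ha, hav⟩
      obtain ⟨w, -, rfl⟩ := Finset.mem_image.1 ha
      rw [hsnd p hp] at hav
      rw [hav]
    · intro v _
      refine Relation.ReflTransGen.mono ?_ _ _ (hreach v)
      rintro x y ⟨hy, rfl⟩
      exact ⟨p y, Finset.mem_image_of_mem _ (by simp [hy]), by ext <;> simp [hsnd p hp]⟩
  · intro p hp q hq hpq
    have hp := (Finset.mem_filter.1 hp).1
    have hq := (Finset.mem_filter.1 hq).1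
    funext v
    by_cases hv : v = r
    · have h1 := Fintype.mem_piFinset.1 hp v
      have h2 := Fintype.mem_piFinset.1 hq v
      rw [parentChoices, if_pos hv, Finset.mem_singleton] at h1 h2
      rw [h1, h2]
    · have h1 : p v ∈ (Finset.univ.erase r).image q := by
        rw [← show (Finset.univ.erase r).image p = _ from hpq]
        exact Finset.mem_image_of_mem _ (by simp [hv])
      obtain ⟨w, -, hw⟩ := Finset.mem_image.1 h1
      have : w = v := by rw [← hsnd q hq w, hw, hsnd p hp]
      rw [← hw, this]
  · intro T hT
    obtain ⟨-, hT⟩ := Finset.mem_filter.1 hT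
    have hex : ∀ v, ∃ a, if v = r then a = ((r, r), 0) else a ∈ T ∧ a.1.2 = v := by
      intro v
      by_cases hv : v = r
      · simp [hv]
      · simpa [hv] using (hT.unique_in v (by simp [hD]) hv).exists
    choose p hp using hex
    have hpT : ∀ v, v ≠ r → p v ∈ T ∧ (p v).1.2 = v := fun v hv => by simpa [hv] using hp v
    have huniq : ∀ a ∈ T, p a.1.2 = a := fun a ha =>
      (hT.unique_in a.1.2 (by simp [hD]) (hT.root a ha)).unique (hpT _ (hT.root a ha)) ⟨ha, rfl⟩
    refine ⟨p, Finset.mem_filter.2 ⟨Fintype.mem_piFinset.2 fun v => ?_, fun v => ?_⟩, ?_⟩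
    · by_cases hv : v = r
      · have := hp v
        rw [if_pos hv] at this
        simp [parentChoices, hv, ← this]
      · rw [parentChoices, if_neg hv, Finset.mem_filter]
        exact ⟨hT.subset (hpT v hv).1, (hpT v hv).2⟩
    · refine Relation.ReflTransGen.mono ?_ _ _ (hT.reach v (by simp [hD]))
      rintro x y ⟨a, ha, haxy⟩
      have h1 := hT.root a ha
      have h2 := huniq a ha
      rw [haxy] at h1 h2
      exact ⟨h1, by rw [h2, haxy]⟩
    · ext a
      rw [Finset.mem_image]
      constructor
      · rintro ⟨v, hv, rfl⟩
        exact (hpT v (Finset.ne_of_mem_erase hv)).1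
      · exact fun ha => ⟨a.1.2, by simp [hT.root a ha], huniq a ha⟩

/-- The Laplacian of in-degrees. -/
def inLaplacian (D : MultiDigraph V) : Matrix V V ℚ :=
  Matrix.of fun v => ∑ a ∈ D.arcSet.filter (fun a => a.1.2 = v),
    (Pi.single v 1 - Pi.single a.1.1 1)

/-- The matrix-tree theorem for multi-digraphs. -/
theorem numArborescencesAt_eq_det (D : MultiDigraph V) (hD : D.verts = Finset.univ) (r : V) :
    (D.numArborescencesAt r : ℚ) = (D.inLaplacian.updateRow r (Pi.single r 1)).det := by
  classical
  have hM : D.inLaplacian.updateRow r (Pi.single r 1) =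
      fun v => ∑ a ∈ D.parentChoices r v,
        ((Pi.single v 1 - if v = r then 0 else Pi.single a.1.1 1 : V → ℚ)) := by
    funext v
    by_cases hv : v = r
    · subst hv; simp [parentChoices]
    · rw [Matrix.updateRow_ne hv, parentChoices, if_neg hv]
      simp only [if_neg hv]
      rfl
  rw [hM, numArborescencesAt_eq_card_parent D hD, Finset.card_filter]
  push_cast
  -- Each row is a sum over the arcs available there, so multilinearity gives one parent matrix per
  -- choice, with determinant 1 or 0 according to reachability.
  refine Eq.trans ?_ (MultilinearMap.map_sum_finset Matrix.detRowAlternating.toMultilinearMap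
    (fun v (a : (V × V) × ℕ) => (Pi.single v 1 - if v = r then 0 else Pi.single a.1.1 1 : V → ℚ))
    (D.parentChoices r)).symm
  refine Finset.sum_congr rfl fun p _ => ?_
  split_ifs with h
  · exact (Matrix.det_parentMatrix_of_reach ℚ r (fun v => (p v).1.1) h).symm
  · exact (Matrix.det_parentMatrix_of_not_reach ℚ r (fun v => (p v).1.1) h).symm

end MultiDigraph

/-! ### The determinant of x + P_σ -/

namespace Matrix

variable {V : Type*} [Fintype V] [DecidableEq V]

theorem permMatrix_eq_ite {W R : Type*} [DecidableEq W] [CommRing R] (σ : Equiv.Perm W) (i j : W) :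
    σ.permMatrix R i j = if σ i = j then 1 else 0 := by
  simp [Equiv.Perm.permMatrix, PEquiv.toMatrix_apply, Equiv.toPEquiv_apply, eq_comm]

/-- Each point is fixed by σ or by τ, so P_σ + P_τ = 1 + P_{στ}. This reduces the determinant to
single cycles. -/
theorem smul_one_add_permMatrix_mul {R : Type*} [CommRing R] (x : R) {σ τ : Equiv.Perm V}
    (h : σ.Disjoint τ) :
    (x • (1 : Matrix V V R) + σ.permMatrix R) * (x • (1 : Matrix V V R) + τ.permMatrix R) =
      (x + 1) • (x • (1 : Matrix V V R) + (σ * τ).permMatrix R) := by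
  have hadd : σ.permMatrix R + τ.permMatrix R = 1 + (σ * τ).permMatrix R := by
    ext i j
    simp only [add_apply, permMatrix_eq_ite, one_apply]
    rcases h i with hi | hi
    · have : (σ * τ) i = τ i := by rw [h.commute.eq, Equiv.Perm.mul_apply, hi]
      rw [hi, this]
    · have : (σ * τ) i = σ i := by rw [Equiv.Perm.mul_apply, hi]
      rw [hi, this, add_comm]
  have hmul : σ.permMatrix R * τ.permMatrix R = (σ * τ).permMatrix R := by
    rw [h.commute.eq, Matrix.permMatrix_mul]
  calc _ = (x * x) • (1 : Matrix V V R) + x • (σ.permMatrix R + τ.permMatrix R) +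
        σ.permMatrix R * τ.permMatrix R := by
        simp only [add_mul, mul_add, smul_mul_assoc, mul_smul_comm, one_mul, mul_one, smul_smul,
          smul_add]
        abel
    _ = _ := by
        rw [hadd, hmul]
        module

/-- A nonzero product needs τ i ∈ {i, c i} for all i. Once τ moves a point, injectivity makes it
follow c along the whole cycle, so τ = c. -/
theorem prod_eq_zero_of_isCycle {R : Type*} [CommRing R] (x : R) {c τ : Equiv.Perm V}
    (hc : c.IsCycle) (h1 : τ ≠ 1) (h2 : τ ≠ c) :
    ∏ i, (x • (1 : Matrix V V R) + c.permMatrix R) i (τ i) = 0 := by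
  by_contra h0
  have hall : ∀ i, τ i = i ∨ τ i = c i := by
    intro i
    by_contra hi
    rw [not_or] at hi
    refine h0 (Finset.prod_eq_zero (Finset.mem_univ i) ?_)
    simp [Ne.symm hi.1, Ne.symm hi.2]
  obtain ⟨i, hi⟩ : ∃ i, τ i ≠ i := by
    by_contra! h
    exact h1 (Equiv.ext h)
  have hic : τ i = c i := (hall i).resolve_left hi
  have hstep : ∀ m : ℕ, τ ((c ^ m) i) = c ((c ^ m) i) ∧ c ((c ^ m) i) ≠ (c ^ m) i := by
    intro m
    induction m with
    | zero => exact ⟨hic, by simpa [← hic] using hi⟩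
    | succ m ih =>
      rw [pow_succ', Equiv.Perm.mul_apply]
      refine ⟨(hall _).resolve_left fun h => ?_, fun h => ih.2 (c.injective h)⟩
      rw [← ih.1] at h
      exact ih.2 (ih.1 ▸ τ.injective h)
  refine h2 (Equiv.ext fun y => ?_)
  by_cases hy : c y = y
  · rcases hall y with h | h
    · rw [h, hy]
    · exact h
  · obtain ⟨m, rfl⟩ := hc.exists_pow_eq (by rw [← hic]; exact hi) hy
    exact (hstep m).1

/-- Only the identity and c survive in the Leibniz sum. The power of x + 1 on the left avoids a
subtraction in the exponent. -/
theorem det_smul_one_add_permMatrix_of_isCycle {R : Type*} [CommRing R] (x : R)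
    {c : Equiv.Perm V} (hc : c.IsCycle) :
    (x • (1 : Matrix V V R) + c.permMatrix R).det * (x + 1) ^ c.support.card =
      (x + 1) ^ Fintype.card V * (x ^ c.support.card + (-1) ^ (c.support.card + 1)) := by
  have hcard : (Finset.univ.filter fun i => c i = i).card + c.support.card = Fintype.card V := by
    rw [Equiv.Perm.support, Finset.card_filter_add_card_filter_not, Finset.card_univ]
  have hs : (Finset.univ.filter fun i => ¬ c i = i) = c.support := by
    ext; simp
  rw [← det_transpose, det_apply',
    Fintype.sum_eq_add (1 : Equiv.Perm V) c hc.ne_one.symm fun τ hτ => by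
      simp only [transpose_apply]
      rw [prod_eq_zero_of_isCycle x hc hτ.1 hτ.2, mul_zero]]
  have e1 : ∏ i, (x • (1 : Matrix V V R) + c.permMatrix R)ᵀ ((1 : Equiv.Perm V) i) i =
      (x + 1) ^ (Finset.univ.filter fun i => c i = i).card * x ^ c.support.card := by
    have : ∀ i, (x • (1 : Matrix V V R) + c.permMatrix R)ᵀ ((1 : Equiv.Perm V) i) i =
        if c i = i then x + 1 else x := by
      intro i
      by_cases h : c i = i <;> simp [h]
    simp only [this, Finset.prod_ite, Finset.prod_const, hs]
  have e2 : ∏ i, (x • (1 : Matrix V V R) + c.permMatrix R)ᵀ (c i) i =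
      (x + 1) ^ (Finset.univ.filter fun i => c i = i).card := by
    have : ∀ i, (x • (1 : Matrix V V R) + c.permMatrix R)ᵀ (c i) i =
        if c i = i then x + 1 else 1 := by
      intro i
      by_cases h : c i = i
      · simp [h]
      · simp [h, Ne.symm h]
    simp only [this, Finset.prod_ite, Finset.prod_const, one_pow, mul_one]
  rw [e1, e2, hc.sign, ← hcard]
  push_cast
  simp
  ring

/-- The determinant of `x + P_σ` in terms of the cycle type of `σ`. -/
theorem det_smul_one_add_permMatrix {K : Type*} [Field K] (x : K) (hx : x + 1 ≠ 0)
    (σ : Equiv.Perm V) :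
    (x • (1 : Matrix V V K) + σ.permMatrix K).det * (x + 1) ^ σ.support.card =
      (x + 1) ^ Fintype.card V * (σ.cycleType.map fun ℓ => x ^ ℓ + (-1) ^ (ℓ + 1)).prod := by
  induction σ using Equiv.Perm.cycle_induction_on with
  | base_one =>
    rw [permMatrix_one, show x • (1 : Matrix V V K) + 1 = (x + 1) • 1 by rw [add_smul, one_smul],
      det_smul]
    simp
  | base_cycles c hc =>
    rw [det_smul_one_add_permMatrix_of_isCycle x hc, hc.cycleType]
    simp
  | induction_disjoint c τ h _ hc hτ =>
    have hd := congrArg det (smul_one_add_permMatrix_mul x h)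
    rw [det_mul, det_smul] at hd
    refine mul_left_cancel₀ (pow_ne_zero (Fintype.card V) hx) ?_
    rw [h.cycleType_mul, h.card_support_mul, Multiset.map_add, Multiset.prod_add, pow_add,
      ← mul_assoc, ← mul_assoc, ← hd]
    linear_combination (x + 1) ^ τ.support.card *
      (x • (1 : Matrix V V K) + τ.permMatrix K).det * hc +
      (x + 1) ^ Fintype.card V * (c.cycleType.map fun ℓ => x ^ ℓ + (-1) ^ (ℓ + 1)).prod * hτ

theorem det_smul_one_add_permMatrix_of_derangement {K : Type*} [Field K] (x : K) (hx : x + 1 ≠ 0)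
    (σ : Equiv.Perm V) (hσ : ∀ i, σ i ≠ i) :
    (x • (1 : Matrix V V K) + σ.permMatrix K).det =
      (σ.cycleType.map fun ℓ => x ^ ℓ + (-1) ^ (ℓ + 1)).prod := by
  have hs : σ.support = Finset.univ := by ext; simp [hσ]
  have h := det_smul_one_add_permMatrix x hx σ
  rw [hs, Finset.card_univ, mul_comm] at h
  exact mul_left_cancel₀ (pow_ne_zero _ hx) h

end Matrix

/-! ### Degrees in rooted digraphs -/

namespace MultiHypergraph

section Rooting

variable {V : Type*} [LinearOrder V]

theorem count_map_fst_bind_starArcs {k : ℕ} (R : List (Finset V × V))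
    (hR : ∀ s ∈ R, s.2 ∈ s.1 ∧ s.1.card = k) (v : V) :
    (((R : Multiset (Finset V × V)).bind starArcs).map Prod.fst).count v =
      (k - 1) * (R.map Prod.snd).count v := by
  induction R with
  | nil => simp
  | cons s R ih =>
    have h1 : (starArcs s).map Prod.fst = Multiset.replicate (k - 1) s.2 := by
      obtain ⟨h2, h3⟩ := hR s (by simp)
      rw [← h3, ← Finset.card_erase_of_mem h2, starArcs, Multiset.map_map]
      exact Multiset.map_const' _ _
    rw [← Multiset.cons_coe, Multiset.cons_bind, Multiset.map_add, Multiset.count_add,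
      ih fun t ht => hR t (by simp [ht]), h1, Multiset.count_replicate, List.map_cons,
      List.count_cons, mul_add]
    by_cases h : s.2 = v <;> simp [h, add_comm]

/-- A star enters each vertex of its edge once, except its root, which the second summand restores.
-/
theorem count_map_snd_bind_starArcs (R : List (Finset V × V))
    (hR : ∀ s ∈ R, s.2 ∈ s.1) (v : V) :
    (((R : Multiset (Finset V × V)).bind starArcs).map Prod.snd).count v +
      (R.map Prod.snd).count v = (R.map Prod.fst).countP (fun e => v ∈ e) := by
  induction R with
  | nil => simp
  | cons s R ih =>
    have h1 : (starArcs s).map Prod.snd = (s.1.erase s.2).val := by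
      simp [starArcs, Multiset.map_map]
    have h2 : Multiset.count v (s.1.erase s.2).val + (if s.2 = v then 1 else 0) =
        if v ∈ s.1 then 1 else 0 := by
      rw [Multiset.count_eq_of_nodup (s.1.erase s.2).nodup]
      simp only [Finset.mem_val, Finset.mem_erase]
      have := hR s (by simp)
      by_cases hv : s.2 = v
      · subst hv; simp [this]
      · simp [hv, Ne.symm hv]
    rw [← Multiset.cons_coe, Multiset.cons_bind, Multiset.map_add, Multiset.count_add,
      h1, List.map_cons, List.map_cons, List.count_cons, List.countP_cons,
      ← ih fun t ht => hR t (by simp [ht])]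
    simp only [beq_iff_eq, decide_eq_true_eq]
    omega

theorem inDeg_rootedDigraph_add (H : MultiHypergraph V) {R : List (Finset V × V)}
    (hR : H.IsRooting R) (v : V) :
    (rootedDigraph R).inDeg v + (R.map Prod.snd).count v = H.degree v := by
  rw [degree, ← hR.edges_eq, Multiset.coe_countP, ← count_map_snd_bind_starArcs R hR.root_mem v,
    Multiset.count_map, MultiDigraph.inDeg, Multiset.countP_eq_card_filter]
  simp [rootedDigraph, eq_comm]

theorem count_map_snd_rootedDigraph (R : List (Finset V × V)) (v : V) :
    ((rootedDigraph R).arcs.map Prod.snd).count v = (rootedDigraph R).inDeg v := by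
  rw [Multiset.count_map, MultiDigraph.inDeg, Multiset.countP_eq_card_filter]
  simp [eq_comm]

/-- The rooted digraph of a rooting of a Veblen hypergraph is balanced iff every vertex is the root
of `deg v / k` edges. -/
theorem balanced_rootedDigraph_iff (H : MultiHypergraph V) {k : ℕ} (hk : 1 ≤ k)
    (hH : ∀ e ∈ H.edges, e.card = k) {R : List (Finset V × V)} (hR : H.IsRooting R) :
    (rootedDigraph R).arcs.map Prod.fst = (rootedDigraph R).arcs.map Prod.snd ↔
      ∀ v, k * (R.map Prod.snd).count v = H.degree v := by
  rw [Multiset.ext]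
  refine forall_congr' fun v => ?_
  have hcard : ∀ s ∈ R, s.2 ∈ s.1 ∧ s.1.card = k := fun s hs =>
    ⟨hR.root_mem s hs, hH _ (by
      rw [← hR.edges_eq, Multiset.mem_coe]; exact List.mem_map_of_mem hs)⟩
  have h1 := count_map_fst_bind_starArcs R hcard v
  have h2 := inDeg_rootedDigraph_add H hR v
  rw [count_map_snd_rootedDigraph, show (rootedDigraph R).arcs =
    (R : Multiset (Finset V × V)).bind starArcs from rfl, h1]
  obtain ⟨m, rfl⟩ := Nat.exists_eq_add_of_le' hk
  rw [Nat.add_sub_cancel, add_one_mul]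
  omega

end Rooting

/-! ### Euler rootings of the simplex and derangements -/

section Simplex

variable {k : ℕ}

/-- The rooting of the simplex in which `v` is the root of the edge that omits `σ v`. -/
def simplexRooting (σ : Equiv.Perm (Fin (k + 1))) : List (Finset (Fin (k + 1)) × Fin (k + 1)) :=
  (List.finRange (k + 1)).map fun v => (Finset.univ.erase (σ v), v)

theorem map_snd_simplexRooting (σ : Equiv.Perm (Fin (k + 1))) :
    (simplexRooting σ).map Prod.snd = List.finRange (k + 1) := by
  simp [simplexRooting, Function.comp_def]

theorem simplexRooting_injective :
    Function.Injective (simplexRooting : Equiv.Perm (Fin (k + 1)) → _) := by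
  intro σ τ h
  ext v : 1
  have h1 := (List.map_inj_left.1 h) v (List.mem_finRange v)
  have h2 : σ v ∉ Finset.univ.erase (τ v) := by
    rw [← (Prod.mk.inj h1).1]; simp
  simpa using h2

theorem isRooting_simplexRooting (σ : Equiv.Perm (Fin (k + 1))) (hσ : ∀ v, σ v ≠ v) :
    (simplexHypergraph k).IsRooting (simplexRooting σ) where
  edges_eq := by
    have hinj : Function.Injective fun v => (Finset.univ : Finset (Fin (k + 1))).erase (σ v) := by
      intro v w h
      have h2 : σ v ∉ Finset.univ.erase (σ w) := by
        rw [← show Finset.univ.erase (σ v) = Finset.univ.erase (σ w) from h]; simp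
      simpa using h2
    refine (Multiset.Nodup.ext ?_ (Finset.nodup _)).2 ?_
    rotate_left
    · intro e
      rw [Finset.mem_val, Finset.mem_powersetCard, Multiset.mem_coe]
      simp only [simplexRooting, List.map_map, List.mem_map, List.mem_finRange, true_and,
        Finset.subset_univ, Function.comp_apply]
      constructor
      · rintro ⟨v, rfl⟩
        simp
      · intro he
        obtain ⟨i, hi⟩ := Finset.card_eq_one.1
          (show eᶜ.card = 1 by rw [Finset.card_compl, Fintype.card_fin, he]; omega)
        refine ⟨σ.symm i, ?_⟩
        rw [← compl_compl e, hi]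
        ext; simp
    · rw [Multiset.coe_nodup, simplexRooting, List.map_map]
      exact (List.nodup_finRange _).map hinj
  root_mem := by
    intro s hs
    obtain ⟨v, -, rfl⟩ := List.mem_map.1 hs
    simp [(hσ v).symm]
  sorted := by
    rw [← List.pairwise_map, map_snd_simplexRooting]
    exact (List.pairwise_lt_finRange _).imp le_of_lt

theorem count_finRange (v : Fin (k + 1)) : (List.finRange (k + 1)).count v = 1 :=
  List.count_eq_one_of_mem (List.nodup_finRange _) (List.mem_finRange v)

theorem mem_arcs_simplexRooting (σ : Equiv.Perm (Fin (k + 1))) (u w : Fin (k + 1)) :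
    (u, w) ∈ (rootedDigraph (simplexRooting σ)).arcs ↔ w ≠ u ∧ w ≠ σ u := by
  simp [rootedDigraph, simplexRooting, starArcs, -Finset.erase_val]

theorem verts_simplexRooting (σ : Equiv.Perm (Fin (k + 1))) :
    (rootedDigraph (simplexRooting σ)).verts = Finset.univ := by
  refine Finset.eq_univ_of_forall fun v => Finset.mem_biUnion.2 ⟨(Finset.univ.erase (σ v), v), ?_⟩
  simp [simplexRooting]

theorem inDeg_simplexRooting (σ : Equiv.Perm (Fin (k + 1))) (hσ : ∀ v, σ v ≠ v)
    (v : Fin (k + 1)) : (rootedDigraph (simplexRooting σ)).inDeg v + 1 = k := by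
  have h := inDeg_rootedDigraph_add _ (isRooting_simplexRooting σ hσ) v
  rwa [map_snd_simplexRooting, count_finRange, simplexHypergraph_degree] at h

/-- The only vertex other than u without an arc from u is σ u. It is reached through any third
vertex x, since σ x ≠ σ u; such an x exists because k + 1 ≥ 3. -/
theorem reach_simplexRooting (hk : 2 ≤ k) (σ : Equiv.Perm (Fin (k + 1)))
    (u w : Fin (k + 1)) : Relation.ReflTransGen
      (fun x y => (x, y) ∈ (rootedDigraph (simplexRooting σ)).arcs) u w := by
  by_cases h1 : w = u
  · rw [h1]
  have h2 : ∀ w, w ≠ u → w ≠ σ u → Relation.ReflTransGen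
      (fun x y => (x, y) ∈ (rootedDigraph (simplexRooting σ)).arcs) u w := fun w h3 h4 =>
    .single ((mem_arcs_simplexRooting σ u w).2 ⟨h3, h4⟩)
  by_cases h3 : w = σ u
  · obtain ⟨x, hx⟩ : ∃ x, x ∉ ({u, σ u} : Finset (Fin (k + 1))) := by
      by_contra! h
      have := Finset.card_le_two (a := u) (b := σ u)
      rw [Finset.eq_univ_of_forall h, Finset.card_univ, Fintype.card_fin] at this
      omega
    simp only [Finset.mem_insert, Finset.mem_singleton, not_or] at hx
    refine (h2 x hx.1 hx.2).tail ((mem_arcs_simplexRooting σ x w).2 ⟨h3 ▸ Ne.symm hx.2, ?_⟩)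
    rw [h3]
    exact fun h => hx.1 (σ.injective h).symm
  · exact h2 w h1 h3

theorem isEulerRooting_simplexRooting (hk : 2 ≤ k) (σ : Equiv.Perm (Fin (k + 1)))
    (hσ : ∀ v, σ v ≠ v) : (simplexHypergraph k).IsEulerRooting (simplexRooting σ) := by
  have hR := isRooting_simplexRooting σ hσ
  refine ⟨hR, MultiDigraph.isEulerian_of_balanced ?_ fun a _ b _ =>
    reach_simplexRooting hk σ a.1 b.1⟩
  refine (balanced_rootedDigraph_iff _ (by omega)
    (fun e he => simplexHypergraph_mem_edges.1 he) hR).2 fun v => ?_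
  rw [map_snd_simplexRooting, count_finRange, simplexHypergraph_degree, mul_one]

theorem exists_derangement_of_isEulerRooting (hk : 1 ≤ k)
    {R : List (Finset (Fin (k + 1)) × Fin (k + 1))} (h : (simplexHypergraph k).IsEulerRooting R) :
    ∃ σ : Equiv.Perm (Fin (k + 1)), (∀ v, σ v ≠ v) ∧ simplexRooting σ = R := by
  obtain ⟨hR, hE⟩ := h
  have hcount := (balanced_rootedDigraph_iff _ hk
    (fun e he => simplexHypergraph_mem_edges.1 he) hR).1 hE.map_fst_eq_map_snd
  have hone : ∀ v, (R.map Prod.snd).count v = 1 := by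
    intro v
    have := hcount v
    rw [simplexHypergraph_degree] at this
    exact Nat.eq_of_mul_eq_mul_left hk (this.trans (mul_one k).symm)
  have hperm : (R.map Prod.snd).Perm (List.finRange (k + 1)) := by
    rw [List.perm_iff_count]
    intro v
    rw [hone, count_finRange]
  -- A sorted list is determined by its multiset of entries, so the roots appear exactly in the
  -- order of `List.finRange`.
  have hmap : R.map Prod.snd = List.finRange (k + 1) :=
    hperm.eq_of_pairwise' (List.pairwise_map.2 hR.sorted)
      ((List.pairwise_lt_finRange _).imp le_of_lt)
  have hnodup : (R.map Prod.snd).Nodup := hmap ▸ List.nodup_finRange _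
  have hfst : (R.map Prod.fst).Nodup := by
    rw [← Multiset.coe_nodup, hR.edges_eq]
    exact Finset.nodup _
  have hex : ∀ v, ∃ s ∈ R, s.2 = v := by
    intro v
    have : v ∈ R.map Prod.snd := hmap ▸ List.mem_finRange v
    simpa using this
  choose g hgR hg using hex
  have hRg : R = (List.finRange (k + 1)).map g := by
    rw [← hmap, List.map_map]
    refine (List.map_id R).symm.trans (List.map_congr_left fun s hs => ?_)
    exact List.inj_on_of_nodup_map hnodup hs (hgR _) (hg _).symm
  have hσ : ∀ v, ∃ i, (g v).1 = Finset.univ.erase i := by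
    intro v
    have he : (g v).1.card = k := by
      rw [← simplexHypergraph_mem_edges, ← hR.edges_eq, Multiset.mem_coe]
      exact List.mem_map_of_mem (hgR v)
    obtain ⟨i, hi⟩ := Finset.card_eq_one.1
      (show (g v).1ᶜ.card = 1 by rw [Finset.card_compl, Fintype.card_fin, he]; omega)
    refine ⟨i, ?_⟩
    rw [← compl_compl (g v).1, hi]
    ext; simp
  choose σ hσ using hσ
  -- The simplex has no repeated edges, so distinct roots omit distinct vertices.
  have hinj : Function.Injective σ := by
    intro v w hvw
    have : g v = g w := List.inj_on_of_nodup_map hfst (hgR v) (hgR w) (by rw [hσ, hσ, hvw])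
    rw [← hg v, this, hg]
  refine ⟨Equiv.ofBijective σ (Finite.injective_iff_bijective.1 hinj), fun v hv => ?_, ?_⟩
  · have := hR.root_mem _ (hgR v)
    rw [hσ, hg] at this
    exact Finset.ne_of_mem_erase this hv.symm
  · rw [hRg]
    refine List.map_congr_left fun v _ => ?_
    rw [Equiv.ofBijective_apply, ← hσ]
    exact Prod.ext rfl (hg v).symm

theorem sum_arcs_simplexRooting {M : Type*} [AddCommMonoid M] (σ : Equiv.Perm (Fin (k + 1)))
    (F : Fin (k + 1) × Fin (k + 1) → M) :
    ((rootedDigraph (simplexRooting σ)).arcs.map F).sum =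
      ∑ v, ∑ w ∈ (Finset.univ.erase (σ v)).erase v, F (v, w) := by
  have : (rootedDigraph (simplexRooting σ)).arcs = (Finset.univ : Finset (Fin (k + 1))).val.bind
      fun v => starArcs (Finset.univ.erase (σ v), v) := by
    simp [rootedDigraph, simplexRooting, ← Multiset.map_coe, Multiset.bind_map, Fin.univ_def]
  rw [this, Multiset.map_bind, Multiset.sum_bind]
  simp [starArcs, Multiset.map_map, Finset.sum]

theorem inLaplacian_simplexRooting (σ : Equiv.Perm (Fin (k + 1))) (hσ : ∀ v, σ v ≠ v)
    (v u : Fin (k + 1)) : (rootedDigraph (simplexRooting σ)).inLaplacian v u =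
      (k : ℚ) * (if v = u then 1 else 0) + (if σ⁻¹ v = u then 1 else 0) - 1 := by
  have h1 : (rootedDigraph (simplexRooting σ)).inLaplacian v u =
      ((rootedDigraph (simplexRooting σ)).arcs.map fun a => if a.2 = v then
        ((if v = u then 1 else 0) - (if a.1 = u then 1 else 0) : ℚ) else 0).sum := by
    rw [← Multiset.map_toEnumFinset_fst (rootedDigraph (simplexRooting σ)).arcs, Multiset.map_map]
    rw [MultiDigraph.inLaplacian, Matrix.of_apply, Finset.sum_apply, Finset.sum_filter]
    refine Finset.sum_congr rfl fun a _ => ?_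
    simp [Pi.single_apply, eq_comm (a := u)]
  rw [h1, sum_arcs_simplexRooting]
  -- The vertex x has an arc to v unless x = v or x = σ⁻¹ v. These cases exclude each other because
  -- σ has no fixed point, so the indicator is 1 minus two indicators.
  have h2 : ∀ x, (∑ w ∈ (Finset.univ.erase (σ x)).erase x, if w = v then
      ((if v = u then 1 else 0) - (if x = u then 1 else 0) : ℚ) else 0) =
      ((if v = u then 1 else 0) - (if x = u then 1 else 0)) -
      (if x = v then ((if v = u then 1 else 0) - (if x = u then 1 else 0)) else 0) -
      (if x = σ⁻¹ v then ((if v = u then 1 else 0) - (if x = u then 1 else 0)) else 0) := by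
    intro x
    rw [Finset.sum_ite_eq']
    have hx : x = σ⁻¹ v ↔ v = σ x := by rw [Equiv.Perm.eq_inv_iff_eq, eq_comm]
    simp only [hx]
    by_cases h3 : x = v
    · subst h3
      simp [(hσ x).symm]
    · by_cases h4 : v = σ x
      · subst h4
        simp [(hσ x).symm]
      · simp [h3, h4, Ne.symm h3]
  simp only [h2, Finset.sum_sub_distrib, Finset.sum_ite_eq', Finset.mem_univ, if_true,
    Finset.sum_const, Finset.card_univ, Fintype.card_fin, nsmul_eq_mul]
  push_cast
  ring

/-- The number of arborescences of the digraph of a derangement. -/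
theorem card_sq_mul_numArborescencesAt_simplexRooting (σ : Equiv.Perm (Fin (k + 1)))
    (hσ : ∀ v, σ v ≠ v) (r : Fin (k + 1)) :
    ((k : ℚ) + 1) ^ 2 * (rootedDigraph (simplexRooting σ)).numArborescencesAt r =
      (σ.cycleType.map fun ℓ => (k : ℚ) ^ ℓ + (-1) ^ (ℓ + 1)).prod := by
  have hL := inLaplacian_simplexRooting σ hσ
  have hrow : (rootedDigraph (simplexRooting σ)).inLaplacian.mulVec 1 = 0 := by
    ext v
    simp [Matrix.mulVec, dotProduct, hL, Finset.sum_add_distrib]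
  have hcol : Matrix.vecMul 1 (rootedDigraph (simplexRooting σ)).inLaplacian = 0 := by
    ext u
    simp [Matrix.vecMul, dotProduct, hL, Finset.sum_add_distrib, Equiv.symm_apply_eq]
  -- Adding J cancels the entries -1. The inverse of σ, which has the same cycle type, appears
  -- because rows are indexed by heads.
  have hadd : (rootedDigraph (simplexRooting σ)).inLaplacian + Matrix.vecMulVec 1 1 =
      (k : ℚ) • 1 + (σ⁻¹).permMatrix ℚ := by
    ext v u
    rw [Matrix.add_apply, hL, Matrix.add_apply, Matrix.permMatrix_eq_ite, Matrix.smul_apply,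
      Matrix.one_apply]
    simp
  have h := Matrix.det_add_one_eq_card_sq_mul _ hrow hcol r
  rw [← Matrix.det_updateRow_single_eq _ hrow, ← MultiDigraph.numArborescencesAt_eq_det _
    (verts_simplexRooting σ), hadd, Matrix.det_smul_one_add_permMatrix_of_derangement _
    (by positivity) _ (fun i hi => hσ i (Equiv.Perm.inv_eq_iff_eq.1 hi).symm),
    Equiv.Perm.cycleType_inv, Fintype.card_fin] at h
  rw [h]
  push_cast
  rfl

theorem sum_eulerRootings_simplex (hk : 2 ≤ k)
    (f : List (Finset (Fin (k + 1)) × Fin (k + 1)) → ℚ) :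
    ∑ R ∈ (simplexHypergraph k).eulerRootings, f R =
      ∑ σ : derangements (Fin (k + 1)), f (simplexRooting (σ : Equiv.Perm (Fin (k + 1)))) := by
  symm
  refine Finset.sum_bij (fun σ _ => simplexRooting (σ : Equiv.Perm (Fin (k + 1)))) ?_ ?_ ?_ ?_
  · intro σ _
    exact (Set.Finite.mem_toFinset _).2 (isEulerRooting_simplexRooting hk _ σ.2)
  · intro σ _ τ _ h
    exact Subtype.ext (simplexRooting_injective h)
  · intro R hR
    have hE : (simplexHypergraph k).IsEulerRooting R :=
      (Set.Finite.mem_toFinset (finite_eulerRootings _)).1 hR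
    obtain ⟨σ, hσ, rfl⟩ := exists_derangement_of_isEulerRooting (by omega) hE
    exact ⟨⟨σ, hσ⟩, Finset.mem_univ _, rfl⟩
  · intro _ _; rfl

theorem prod_inDeg_simplexRooting (σ : Equiv.Perm (Fin (k + 1))) (hσ : ∀ v, σ v ≠ v) :
    ∏ v ∈ (rootedDigraph (simplexRooting σ)).verts,
      ((rootedDigraph (simplexRooting σ)).inDeg v : ℚ) = ((k : ℚ) - 1) ^ (k + 1) := by
  rw [verts_simplexRooting, Finset.prod_congr rfl fun v _ => show _ = (k : ℚ) - 1 from ?_]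
  · simp
  · rw [eq_sub_iff_add_eq]
    exact_mod_cast inDeg_simplexRooting σ hσ v

end Simplex

end MultiHypergraph

theorem theoremT (k : ℕ) (hk : 2 ≤ k) :
    (∀ r : Fin (k + 1),
      (simplex k hk).assocCoeff r =
        1 / (((k : ℚ) - 1) ^ (k + 1) * ((k : ℚ) + 1) ^ 2) *
          ∑ σ : derangements (Fin (k + 1)),
            ((σ : Equiv.Perm (Fin (k + 1))).cycleType.map
              (fun ℓ => (k : ℚ) ^ ℓ + (-1) ^ (ℓ + 1))).prod) ∧
    (simplex k hk).assocCoeffAllRoots =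
      1 / (((k : ℚ) - 1) ^ (k + 1) * ((k : ℚ) + 1)) *
        ∑ σ : derangements (Fin (k + 1)),
          ((σ : Equiv.Perm (Fin (k + 1))).cycleType.map
            (fun ℓ => (k : ℚ) ^ ℓ + (-1) ^ (ℓ + 1))).prod := by
  have hk1 : ((k : ℚ) - 1) ≠ 0 := by
    have : (2 : ℚ) ≤ k := by exact_mod_cast hk
    linarith
  have hk2 : ((k : ℚ) + 1) ≠ 0 := by positivity
  constructor
  · intro r
    rw [ConnectedVeblen.assocCoeff, show (simplex k hk).toMultiHypergraph = simplexHypergraph k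
      from rfl, MultiHypergraph.sum_eulerRootings_simplex hk, Finset.mul_sum]
    refine Finset.sum_congr rfl fun σ _ => ?_
    rw [MultiHypergraph.prod_inDeg_simplexRooting _ σ.2,
      ← MultiHypergraph.card_sq_mul_numArborescencesAt_simplexRooting _ σ.2 r]
    field_simp
  · rw [ConnectedVeblen.assocCoeffAllRoots, show (simplex k hk).toMultiHypergraph =
      simplexHypergraph k from rfl, MultiHypergraph.sum_eulerRootings_simplex hk, Finset.mul_sum]
    refine Finset.sum_congr rfl fun σ _ => ?_
    rw [MultiHypergraph.prod_inDeg_simplexRooting _ σ.2, MultiDigraph.numArborescences, MultiHypergraph.verts_simplexRooting]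
    have h := fun r => MultiHypergraph.card_sq_mul_numArborescencesAt_simplexRooting _ σ.2 r
    -- All k + 1 roots contribute equally, which cancels one of the two factors k + 1.
    have hsum : ((k : ℚ) + 1) * (∑ r, (MultiHypergraph.rootedDigraph (MultiHypergraph.simplexRooting
        (σ : Equiv.Perm (Fin (k + 1))))).numArborescencesAt r : ℕ) =
        ((σ : Equiv.Perm (Fin (k + 1))).cycleType.map
          (fun ℓ => (k : ℚ) ^ ℓ + (-1) ^ (ℓ + 1))).prod := by
      refine mul_left_cancel₀ hk2 ?_
      push_cast
      rw [← mul_assoc, ← sq, Finset.mul_sum, Finset.sum_congr rfl fun r _ => h r]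
      simp
    rw [← hsum]
    field_simp
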